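/- For probability measures $P,Q$ on the same space let $\mathrm{TV}(P\|Q)=\sup_A|P(A)-Q(A)|$ be the total variation distance. For $K\ge 1$ clients with original model parameters distributed as $P_k^{\mathcal O}$ and protected model parameters distributed as $P_k^{\mathcal D}$, the privacy leakage is $$\epsilon_p=\frac1K\sum_{k=1}^K\bigl(1-\mathrm{TV}(P_k^{\mathcal O}\|P_k^{\mathcal D})\bigr).$$ **Randomization.** There are absolute constants $0<c$, $0<C$ such that the following holds. Let $K\ge1$, let $d_w$ be the dimension of the model weights, $c_{\mathrm{clip}}>0$ the clip norm and $\sigma_{\mathrm{rd}}\ge 0$ the standard deviation of the noise. For every client $k$ let $P_k^{\mathcal O}=\mathcal N(\mu_k,c_{\mathrm{clip}}^2I_{d_w})$ with $\mu_k\in\mathbb R^{d_w}$, and let $P_k^{\mathcal D}$ be the law of $W_k^{\mathcal O}+Z_k$, where $W_k^{\mathcal O}\sim P_k^{\mathcal O}$ and $Z_k\sim\mathcal N(0,\sigma_{\mathrm{rd}}^2I_{d_w})$ are independent. Put $x=\frac{\sigma_{\mathrm{rd}}^2}{c_{\mathrm{clip}}^2}\sqrt{d_w}$. Then $$\epsilon_p=1-\min\{1,\theta\}\quad\text{for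 some }\theta\text{ with}\quad c\,\min\{1,x\}\le\theta\le C\,x .$$ In particular $\theta=\Theta(x)$ in the range $x\le 1$. **Sparsification.** For all $0<a\le b$ there are constants $0<c$, $0<C$, depending only on $a$ and $b$, such that the following holds. Let $K\ge1$ and let the weight vector of each client consist of $q$ shared and $r=n-q$ retained coordinates. For every client $k$ let $$P_k^{\mathcal O}=\mathcal N\bigl((\mu_{u,k},\mu_{o,k}),\ \Sigma_{0,k}\bigr),\quad \Sigma_{0,k}=\mathrm{diag}(\Sigma_{u,k},\Sigma_{o,k}),\qquad P_k^{\mathcal D}=\mathcal N\bigl((\mu_{u,k},\mu_{g,k}),\ \Sigma_k\bigr),\quad \Sigma_k=\mathrm{diag}(\Sigma_{u,k},\Sigma_{g,k}),$$ where $\Sigma_{u,k}$, $\Sigma_{o,k}$, $\Sigma_{g,k}$ are diagonal, $\Sigma_{u,k}$ has positive diagonal entries, and the diagonal entries of $\Sigma_{o,k}$ and $\Sigma_{g,k}$ lie in $[a,b]$. Put $\mu_k=\mu_{o,k}-\mu_{g,k}\in\mathbb R^{r}$ (the mean vector of the retained weights, if $\mu_{g,k}=0$) and $$\delta_k=-\log\frac{\det(\Sigma_{0,k})^{1/4}\det(\Sigma_k)^{1/4}}{\det\bigl(\tfrac{\Sigma_{0,k}+\Sigma_k}{2}\bigr)^{1/2}}$$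 (which is $0$ if $\Sigma_{o,k}=\Sigma_{g,k}$). Then $$\epsilon_p=\frac1K\sum_{k=1}^K\Bigl(1-\sqrt2\,\bigl(1-\exp\{-f_k\}\bigr)^{1/2}\Bigr)$$ for some real numbers $f_k$ with $$c\,\min\{1,\|\mu_k\|^2\}\le f_k\le \delta_k+C\,\|\mu_k\|^2\quad\text{and}\quad f_k\le\delta_k+C\,\|\mu_k\| ,$$ where $\|\cdot\|$ is the Euclidean norm. -/

import Mathlib

open MeasureTheory ProbabilityTheory

noncomputable section

/-- Total variation distance `sup_A |P(A) - Q(A)|`, over measurable sets `A`. -/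
def tvDist {Ω : Type*} [MeasurableSpace Ω] (P Q : Measure Ω) : ℝ :=
  ⨆ A : {A : Set Ω // MeasurableSet A}, |P.real A - Q.real A|

/-- Privacy leakage `ε_p = (1/K) ∑ₖ (1 - TV(Pₖᴼ ‖ Pₖᴰ))` of `K` clients, where `PO k` and `PD k` are
the distributions of the original and of the protected model parameters of client `k`. -/
def privacyLeakage {Ω : Type*} [MeasurableSpace Ω] {K : ℕ} (PO PD : Fin K → Measure Ω) : ℝ :=
  (1 / (K : ℝ)) * ∑ k, (1 - tvDist (PO k) (PD k))

/-- Isotropic Gaussian `N(μ, s² I_d)` on `ℝ^d`, with standard deviation `s` per coordinate. -/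
def isoGaussian {d : ℕ} (μ : EuclideanSpace ℝ (Fin d)) (s : ℝ) :
    Measure (EuclideanSpace ℝ (Fin d)) :=
  multivariateGaussian μ (s ^ 2 • (1 : Matrix (Fin d) (Fin d) ℝ))

/-- Randomization: the law of `W + Z`, where `W ∼ P` and `Z ∼ N(0, σ² I_d)` are independent. -/
def randomize {d : ℕ} (σ : ℝ) (P : Measure (EuclideanSpace ℝ (Fin d))) :
    Measure (EuclideanSpace ℝ (Fin d)) :=
  Measure.conv P (isoGaussian 0 σ)

/-- Block-diagonal covariance matrix `diag(Σ₁, Σ₂)` with diagonal blocks; `v` and `w` are the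
variances of the coordinates of the first and of the second block. -/
def blockCov {q r : ℕ} (v : Fin q → ℝ) (w : Fin r → ℝ) :
    Matrix (Fin q ⊕ Fin r) (Fin q ⊕ Fin r) ℝ :=
  Matrix.fromBlocks (Matrix.diagonal v) 0 0 (Matrix.diagonal w)

/-- Gaussian `N((μ₁, μ₂), diag(Σ₁, Σ₂))` on `ℝ^q × ℝ^r`, with diagonal covariance. -/
def blockGaussian {q r : ℕ} (μ₁ : EuclideanSpace ℝ (Fin q)) (μ₂ : EuclideanSpace ℝ (Fin r))
    (v : Fin q → ℝ) (w : Fin r → ℝ) : Measure (EuclideanSpace ℝ (Fin q ⊕ Fin r)) :=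
  multivariateGaussian (WithLp.toLp 2 (Sum.elim μ₁ μ₂)) (blockCov v w)

/-- The covariance term `- log (det Σ₁ ^ (1/4) * det Σ₂ ^ (1/4) / det ((Σ₁ + Σ₂) / 2) ^ (1/2))` of
the Hellinger affinity of two Gaussians. It vanishes when `Σ₁ = Σ₂`. -/
def covGap {ι : Type*} [Fintype ι] [DecidableEq ι] (S₁ S₂ : Matrix ι ι ℝ) : ℝ :=
  -Real.log (S₁.det ^ (1 / 4 : ℝ) * S₂.det ^ (1 / 4 : ℝ) /
    ((1 / 2 : ℝ) • (S₁ + S₂)).det ^ (1 / 2 : ℝ))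

end

/-! ### Total variation against Hellinger affinity. -/

section TotalVariation

variable {Ω : Type*} [MeasurableSpace Ω]

/-! Everything reduces to the total variation distance `T` of two Gaussians with diagonal
covariance. Upper bounds come from `T² ≤ 2(1 - B)`, where the Hellinger affinity `B` is an explicit
exponential (`sq_tvDist_multivariateGaussian_le`); lower bounds come from explicit test events.

Randomization compares concentric isotropic Gaussians with variance ratio `1 + s`, `s = σ² /
cclip²`. The affinity exponent is at most `d s² / 16`, hence `T ≤ s√d`. For the converse, enlarging
the variance shifts the logarithm of the chi-squared squared radius by `log (1 + s)`, while half of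
the chi-squared law lies in a logarithmic window of length `O(1/√d)`
(`exists_chiSquared_log_width`). For `s ≤ 1`, about `1 + 1/(s√d)` shifts cover that window, and each
accounts for mass at most `T` (`exists_le_tvDist_isotropic`).

Sparsification: solving `T = √2 √(1 - e⁻ᶠ)` forces `f = -log (1 - T²/2)`. The affinity bound turns
into the upper bounds on `f`. A half-space orthogonal to the difference of means gives `T ≥ c min(1,
‖μ‖)` (`le_tvDist_multivariateGaussian`), and `f ≥ T²/2`. -/

lemma abs_measureReal_sub_le_one (P Q : Measure Ω) [IsProbabilityMeasure P]
    [IsProbabilityMeasure Q] (A : Set Ω) : |P.real A - Q.real A| ≤ 1 := by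
  have h1 : P.real A ≤ 1 := measureReal_le_one
  have h2 : Q.real A ≤ 1 := measureReal_le_one
  have h3 : 0 ≤ P.real A := measureReal_nonneg
  have h4 : 0 ≤ Q.real A := measureReal_nonneg
  rw [abs_le]
  constructor <;> linarith

lemma abs_measureReal_sub_le_tvDist (P Q : Measure Ω) [IsProbabilityMeasure P]
    [IsProbabilityMeasure Q] {A : Set Ω} (hA : MeasurableSet A) :
    |P.real A - Q.real A| ≤ tvDist P Q :=
  le_ciSup (f := fun A : {A : Set Ω // MeasurableSet A} => |P.real A - Q.real A|)
    ⟨1, by rintro _ ⟨A, rfl⟩; exact abs_measureReal_sub_le_one P Q A⟩ ⟨A, hA⟩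

lemma tvDist_le {P Q : Measure Ω} {B : ℝ}
    (h : ∀ A, MeasurableSet A → |P.real A - Q.real A| ≤ B) : tvDist P Q ≤ B :=
  haveI : Nonempty {A : Set Ω // MeasurableSet A} := ⟨⟨∅, .empty⟩⟩
  ciSup_le fun A => h A A.2

lemma tvDist_nonneg (P Q : Measure Ω) : 0 ≤ tvDist P Q :=
  Real.iSup_nonneg fun _ => abs_nonneg _

lemma tvDist_le_one (P Q : Measure Ω) [IsProbabilityMeasure P] [IsProbabilityMeasure Q] :
    tvDist P Q ≤ 1 :=
  tvDist_le fun A _ => abs_measureReal_sub_le_one P Q A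

/-- The squared total variation distance is at most twice the squared Hellinger distance. -/
lemma sq_setIntegral_sub_le {μ : Measure Ω} {p q : Ω → ℝ} (hp : Integrable p μ)
    (hq : Integrable q μ) (hp0 : ∀ x, 0 ≤ p x) (hq0 : ∀ x, 0 ≤ q x) (hp1 : ∫ x, p x ∂μ = 1)
    (hq1 : ∫ x, q x ∂μ = 1) {A : Set Ω} (hA : MeasurableSet A) :
    (∫ x in A, p x ∂μ - ∫ x in A, q x ∂μ) ^ 2 ≤ 2 * (1 - ∫ x, √(p x * q x) ∂μ) := by
  have hpA := integral_add_compl hA hp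
  have hqA := integral_add_compl hA hq
  have hpm : MemLp (fun x => √(p x)) 2 μ := by
    rw [memLp_two_iff_integrable_sq (hp.aestronglyMeasurable.aemeasurable.sqrt.aestronglyMeasurable)]
    exact hp.congr (.of_forall fun x => (Real.sq_sqrt (hp0 x)).symm)
  have hqm : MemLp (fun x => √(q x)) 2 μ := by
    rw [memLp_two_iff_integrable_sq (hq.aestronglyMeasurable.aemeasurable.sqrt.aestronglyMeasurable)]
    exact hq.congr (.of_forall fun x => (Real.sq_sqrt (hq0 x)).symm)
  have hpq : Integrable (fun x => √(p x * q x)) μ :=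
    (hpm.integrable_mul hqm).congr (.of_forall fun x => (Real.sqrt_mul (hp0 x) _).symm)
  set B := ∫ x, √(p x * q x) ∂μ with hB
  have hB0 : 0 ≤ B := integral_nonneg fun x => Real.sqrt_nonneg _
  have hdiff : Integrable (fun x => p x - q x) μ := hp.sub hq
  -- Both densities have mass one, so `A` and its complement carry opposite discrepancies; this is
  -- the factor 2.
  have habs : 2 * |∫ x in A, p x ∂μ - ∫ x in A, q x ∂μ| ≤ ∫ x, |p x - q x| ∂μ := by
    have e1 : ∫ x in A, p x ∂μ - ∫ x in A, q x ∂μ = ∫ x in A, (p x - q x) ∂μ :=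
      (integral_sub hp.integrableOn hq.integrableOn).symm
    have e2 : ∫ x in Aᶜ, (p x - q x) ∂μ = ∫ x in Aᶜ, p x ∂μ - ∫ x in Aᶜ, q x ∂μ :=
      integral_sub hp.integrableOn hq.integrableOn
    have e3 : |∫ x in A, (p x - q x) ∂μ| = |∫ x in Aᶜ, (p x - q x) ∂μ| := by
      rw [← abs_neg]; congr 1; linarith
    have i1 := abs_integral_le_integral_abs (f := fun x => p x - q x) (μ := μ.restrict A)
    have i2 := abs_integral_le_integral_abs (f := fun x => p x - q x) (μ := μ.restrict Aᶜ)
    have := integral_add_compl hA hdiff.abs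
    rw [e1]; linarith
  -- Cauchy–Schwarz after factoring `|p - q| = |√p - √q| (√p + √q)`.
  have hcs : ∫ x, |p x - q x| ∂μ ≤ √(2 - 2 * B) * √(2 + 2 * B) := by
    have hf : MemLp (fun x => |√(p x) - √(q x)|) 2 μ := (hpm.sub hqm).abs
    have hg : MemLp (fun x => √(p x) + √(q x)) 2 μ := hpm.add hqm
    have := integral_mul_le_Lp_mul_Lq_of_nonneg (μ := μ) Real.HolderConjugate.two_two
      (f := fun x => |√(p x) - √(q x)|) (g := fun x => √(p x) + √(q x))
      (.of_forall fun x => abs_nonneg _)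
      (.of_forall fun x => add_nonneg (Real.sqrt_nonneg _) (Real.sqrt_nonneg _))
      (by simpa using hf) (by simpa using hg)
    have e0 : ∀ x, |√(p x) - √(q x)| * (√(p x) + √(q x)) = |p x - q x| := fun x => by
      rw [← abs_of_nonneg (add_nonneg (Real.sqrt_nonneg (p x)) (Real.sqrt_nonneg (q x))),
        ← abs_mul]
      congr 1
      nlinarith [Real.sq_sqrt (hp0 x), Real.sq_sqrt (hq0 x)]
    have e1 : ∀ x, |√(p x) - √(q x)| ^ (2 : ℝ) = p x + q x - 2 * √(p x * q x) := fun x => by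
      rw [Real.rpow_two, sq_abs, Real.sqrt_mul (hp0 x)]
      nlinarith [Real.sq_sqrt (hp0 x), Real.sq_sqrt (hq0 x)]
    have e2 : ∀ x, (√(p x) + √(q x)) ^ (2 : ℝ) = p x + q x + 2 * √(p x * q x) := fun x => by
      rw [Real.rpow_two, Real.sqrt_mul (hp0 x)]
      nlinarith [Real.sq_sqrt (hp0 x), Real.sq_sqrt (hq0 x)]
    simp_rw [e0, e1, e2] at this
    have hsum : Integrable (fun x => p x + q x) μ := hp.add hq
    rw [integral_sub hsum (hpq.const_mul 2), integral_add hsum (hpq.const_mul 2),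
      integral_add hp hq, hp1, hq1, integral_const_mul, ← hB, ← Real.sqrt_eq_rpow,
      ← Real.sqrt_eq_rpow] at this
    norm_num at this
    exact this
  have hB1 : 0 ≤ 1 - B := by
    have : ∫ x, √(p x * q x) ∂μ ≤ ∫ x, (1 / 2) * (p x + q x) ∂μ := by
      refine integral_mono hpq ((hp.add hq).const_mul _) fun x => ?_
      dsimp only
      rw [Real.sqrt_mul (hp0 x)]
      nlinarith [Real.sq_sqrt (hp0 x), Real.sq_sqrt (hq0 x), sq_nonneg (√(p x) - √(q x))]
    rw [integral_const_mul, integral_add hp hq, hp1, hq1] at this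
    linarith
  have h2 : (2 * |∫ x in A, p x ∂μ - ∫ x in A, q x ∂μ|) ^ 2 ≤ (2 - 2 * B) * (2 + 2 * B) := by
    calc _ ≤ (√(2 - 2 * B) * √(2 + 2 * B)) ^ 2 := by
          exact pow_le_pow_left₀ (by positivity) (habs.trans hcs) 2
      _ = _ := by rw [mul_pow, Real.sq_sqrt (by linarith), Real.sq_sqrt (by linarith)]
  rw [mul_pow, sq_abs] at h2
  -- `1 - B² ≤ 2(1 - B)`, the difference being `(1 - B)²`.
  nlinarith

end TotalVariation

/-! ### Hellinger affinity of Gaussians with diagonal covariance. -/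

section GaussianAffinity

/-- Covariance part of minus the logarithm of the Hellinger affinity of two real Gaussians with
variances `v` and `w`. -/
noncomputable def varGap (v w : ℝ) : ℝ :=
  1 / 2 * Real.log ((v + w) / 2) - 1 / 4 * Real.log v - 1 / 4 * Real.log w

/-- Completing the square: the geometric mean of two Gaussian densities is a multiple of the
Gaussian density whose precision is the average of the two precisions. The prefactor is the
affinity. -/
lemma sqrt_gaussianPDFReal_mul {m₁ m₂ v w : ℝ} (hv : 0 < v) (hw : 0 < w) (x : ℝ) :
    √(gaussianPDFReal m₁ v.toNNReal x * gaussianPDFReal m₂ w.toNNReal x) =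
      Real.exp (-(varGap v w + (m₁ - m₂) ^ 2 / (4 * (v + w)))) *
        gaussianPDFReal ((m₁ * w + m₂ * v) / (v + w)) (2 * v * w / (v + w)).toNNReal x := by
  have hvw : 0 < v + w := by positivity
  have h2 : 0 < 2 * v * w / (v + w) := by positivity
  have hexp : Real.exp (-varGap v w) ^ 2 = √(v * w) * 2 / (v + w) := by
    rw [← Real.exp_nat_mul, varGap]
    have : ((2 : ℕ) : ℝ) * -(1 / 2 * Real.log ((v + w) / 2) - 1 / 4 * Real.log v
        - 1 / 4 * Real.log w) = Real.log (√(v * w) * 2 / (v + w)) := by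
      rw [Real.log_div hvw.ne' two_ne_zero,
        Real.log_div (x := √(v * w) * 2) (by positivity) hvw.ne',
        Real.log_mul (by positivity) (by positivity),
        Real.log_sqrt (by positivity), Real.log_mul (by positivity) (by positivity)]
      push_cast
      ring
    rw [this, Real.exp_log (by positivity)]
  rw [Real.sqrt_eq_iff_mul_self_eq (by
    exact mul_nonneg (gaussianPDFReal_nonneg _ _ _) (gaussianPDFReal_nonneg _ _ _))
    (mul_nonneg (Real.exp_pos _).le (gaussianPDFReal_nonneg _ _ _))]
  simp only [gaussianPDFReal, Real.coe_toNNReal _ hv.le, Real.coe_toNNReal _ hw.le,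
    Real.coe_toNNReal _ h2.le]
  set E := Real.exp (-(x - (m₁ * w + m₂ * v) / (v + w)) ^ 2 / (2 * (2 * v * w / (v + w)))) with hE
  have e1 : Real.exp (-(x - m₁) ^ 2 / (2 * v)) * Real.exp (-(x - m₂) ^ 2 / (2 * w)) =
      Real.exp (-((m₁ - m₂) ^ 2 / (4 * (v + w)))) ^ 2 * E ^ 2 := by
    rw [hE, ← Real.exp_add, ← Real.exp_nat_mul, ← Real.exp_nat_mul, ← Real.exp_add]
    congr 1
    push_cast
    field_simp
    ring
  have e2 : (√(2 * Real.pi * v))⁻¹ * (√(2 * Real.pi * w))⁻¹ =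
      Real.exp (-varGap v w) ^ 2 * ((√(2 * Real.pi * (2 * v * w / (v + w))))⁻¹) ^ 2 := by
    rw [hexp, inv_pow, Real.sq_sqrt (by positivity), ← mul_inv, ← Real.sqrt_mul (by positivity)]
    have : 2 * Real.pi * v * (2 * Real.pi * w) = (2 * Real.pi) ^ 2 * (v * w) := by ring
    rw [this, Real.sqrt_mul (by positivity), Real.sqrt_sq (by positivity)]
    have hs : √(v * w) ^ 2 = v * w := Real.sq_sqrt (by positivity)
    have hs0 : 0 < √(v * w) := Real.sqrt_pos.2 (by positivity)
    field_simp
    rw [hs]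
  rw [neg_add, Real.exp_add]
  rw [mul_mul_mul_comm, e1, e2]
  ring

lemma integral_sqrt_gaussianPDFReal_mul {m₁ m₂ v w : ℝ} (hv : 0 < v) (hw : 0 < w) :
    ∫ x, √(gaussianPDFReal m₁ v.toNNReal x * gaussianPDFReal m₂ w.toNNReal x) =
      Real.exp (-(varGap v w + (m₁ - m₂) ^ 2 / (4 * (v + w)))) := by
  have h2 : 0 < 2 * v * w / (v + w) := by positivity
  simp_rw [sqrt_gaussianPDFReal_mul hv hw]
  rw [integral_const_mul, integral_gaussianPDFReal_eq_one _ (by simpa using h2), mul_one]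

/-- `4 * varGap v w` is the logarithm of the squared ratio of arithmetic to geometric mean; `log y ≤
y - 1` bounds it. -/
lemma varGap_le {v w : ℝ} (hv : 0 < v) (hw : 0 < w) :
    varGap v w ≤ (v - w) ^ 2 / (16 * (v * w)) := by
  have h := Real.log_le_sub_one_of_pos (x := ((v + w) / 2) ^ 2 / (v * w)) (by positivity)
  rw [Real.log_div (by positivity) (by positivity), Real.log_pow,
    Real.log_mul (by positivity) (by positivity)] at h
  have e : ((v + w) / 2) ^ 2 / (v * w) - 1 = 4 * ((v - w) ^ 2 / (16 * (v * w))) := by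
    field_simp; ring
  rw [e] at h
  push_cast at h
  unfold varGap
  linarith

lemma varGap_nonneg {v w : ℝ} (hv : 0 < v) (hw : 0 < w) : 0 ≤ varGap v w := by
  have h : Real.log (v * w) ≤ Real.log (((v + w) / 2) ^ 2) :=
    Real.log_le_log (by positivity) (by nlinarith [sq_nonneg (v - w)])
  rw [Real.log_pow, Real.log_mul (by positivity) (by positivity)] at h
  push_cast at h
  unfold varGap
  linarith

variable {ι : Type*} [Fintype ι]

lemma covGap_diagonal [DecidableEq ι] {v w : ι → ℝ} (hv : ∀ i, 0 < v i) (hw : ∀ i, 0 < w i) :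
    covGap (Matrix.diagonal v) (Matrix.diagonal w) = ∑ i, varGap (v i) (w i) := by
  have hd : ((1 / 2 : ℝ) • (Matrix.diagonal v + Matrix.diagonal w)) =
      Matrix.diagonal fun i => (v i + w i) / 2 := by
    rw [Matrix.diagonal_add, ← Matrix.diagonal_smul]
    congr 1
    ext i
    simp
    ring
  have h1 : 0 < ∏ i, v i := Finset.prod_pos fun i _ => hv i
  have h2 : 0 < ∏ i, w i := Finset.prod_pos fun i _ => hw i
  have h3 : 0 < ∏ i, (v i + w i) / 2 := Finset.prod_pos fun i _ => by
    have := hv i; have := hw i; positivity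
  rw [covGap, hd, Matrix.det_diagonal, Matrix.det_diagonal, Matrix.det_diagonal,
    Real.log_div (by positivity) (by positivity), Real.log_mul (by positivity) (by positivity),
    Real.log_rpow h1, Real.log_rpow h2, Real.log_rpow h3,
    Real.log_prod fun i _ => (hv i).ne', Real.log_prod fun i _ => (hw i).ne',
    Real.log_prod fun i _ => (by have := hv i; have := hw i; positivity)]
  simp only [varGap, Finset.sum_sub_distrib, ← Finset.mul_sum]
  ring

/-- Density of a product of nondegenerate real Gaussians. -/
noncomputable def gaussianPiPDFReal (m v : ι → ℝ) (x : ι → ℝ) : ℝ :=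
  ∏ i, gaussianPDFReal (m i) (v i).toNNReal (x i)

lemma gaussianPiPDFReal_nonneg (m v x : ι → ℝ) : 0 ≤ gaussianPiPDFReal m v x :=
  Finset.prod_nonneg fun _ _ => gaussianPDFReal_nonneg _ _ _

lemma integrable_gaussianPiPDFReal (m v : ι → ℝ) : Integrable (gaussianPiPDFReal m v) :=
  Integrable.fintype_prod fun i => integrable_gaussianPDFReal (m i) (v i).toNNReal

lemma integral_gaussianPiPDFReal (m : ι → ℝ) {v : ι → ℝ} (hv : ∀ i, 0 < v i) :
    ∫ x, gaussianPiPDFReal m v x = 1 := by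
  unfold gaussianPiPDFReal
  rw [integral_fintype_prod_volume_eq_prod fun i x => gaussianPDFReal (m i) (v i).toNNReal x]
  exact Finset.prod_eq_one fun i _ =>
    integral_gaussianPDFReal_eq_one _ (by simpa using hv i)

lemma pi_gaussianReal_eq_withDensity (m : ι → ℝ) {v : ι → ℝ} (hv : ∀ i, 0 < v i) :
    Measure.pi (fun i => gaussianReal (m i) (v i).toNNReal) =
      volume.withDensity fun x => ENNReal.ofReal (gaussianPiPDFReal m v x) := by
  refine Measure.pi_eq fun s hs => ?_
  rw [withDensity_apply _ (.univ_pi hs), ← ofReal_integral_eq_lintegral_ofReal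
    (integrable_gaussianPiPDFReal m v).integrableOn
    (.of_forall fun x => gaussianPiPDFReal_nonneg m v x), volume_pi, Measure.restrict_pi_pi]
  unfold gaussianPiPDFReal
  rw [integral_fintype_prod_eq_prod fun i x => gaussianPDFReal (m i) (v i).toNNReal x,
    ENNReal.ofReal_prod_of_nonneg fun i _ =>
      integral_nonneg fun x => gaussianPDFReal_nonneg _ _ _]
  exact Finset.prod_congr rfl fun i _ =>
    (gaussianReal_apply_eq_integral _ (by simpa using hv i) _).symm

lemma measureReal_pi_gaussianReal (m : ι → ℝ) {v : ι → ℝ} (hv : ∀ i, 0 < v i)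
    {A : Set (ι → ℝ)} (hA : MeasurableSet A) :
    (Measure.pi fun i => gaussianReal (m i) (v i).toNNReal).real A =
      ∫ x in A, gaussianPiPDFReal m v x := by
  rw [pi_gaussianReal_eq_withDensity m hv, Measure.real, withDensity_apply _ hA,
    ← ofReal_integral_eq_lintegral_ofReal (integrable_gaussianPiPDFReal m v).integrableOn
      (.of_forall fun x => gaussianPiPDFReal_nonneg m v x),
    ENNReal.toReal_ofReal (integral_nonneg fun x => gaussianPiPDFReal_nonneg m v x)]

variable [DecidableEq ι]

/-- Gives access to a product density; the two characteristic functions agree. -/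
lemma multivariateGaussian_diagonal (m : EuclideanSpace ℝ ι) {v : ι → ℝ} (hv : ∀ i, 0 ≤ v i) :
    multivariateGaussian m (Matrix.diagonal v) =
      (Measure.pi fun i => gaussianReal (m i) (v i).toNNReal).map (WithLp.toLp 2) := by
  apply Measure.ext_of_charFun (E := EuclideanSpace ℝ ι)
  ext t
  rw [charFun_multivariateGaussian (Matrix.PosSemidef.diagonal hv), charFun_pi]
  simp_rw [charFun_gaussianReal, ← Complex.exp_sum, PiLp.inner_apply]
  congr 1
  simp only [RCLike.inner_apply, conj_trivial, dotProduct, Matrix.mulVec_diagonal,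
    Finset.sum_sub_distrib, Complex.ofReal_sum, Complex.ofReal_mul, Finset.sum_mul,
    Finset.sum_div, Real.coe_toNNReal _ (hv _)]
  congr 1 <;> refine Finset.sum_congr rfl fun i _ => by ring

/-- Hellinger bound for the total variation distance of Gaussians with diagonal covariance. -/
theorem sq_tvDist_multivariateGaussian_le (m m' : EuclideanSpace ℝ ι) {v w : ι → ℝ}
    (hv : ∀ i, 0 < v i) (hw : ∀ i, 0 < w i) :
    tvDist (multivariateGaussian m (Matrix.diagonal v))
      (multivariateGaussian m' (Matrix.diagonal w)) ^ 2 ≤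
      2 * (1 - Real.exp (-(covGap (Matrix.diagonal v) (Matrix.diagonal w) +
        ∑ i, (m i - m' i) ^ 2 / (4 * (v i + w i))))) := by
  -- The affinity factorises over the coordinates.
  have hB : ∫ x, √(gaussianPiPDFReal m v x * gaussianPiPDFReal m' w x) =
      Real.exp (-(covGap (Matrix.diagonal v) (Matrix.diagonal w) +
        ∑ i, (m i - m' i) ^ 2 / (4 * (v i + w i)))) := by
    have h : ∀ x : ι → ℝ, √(gaussianPiPDFReal m v x * gaussianPiPDFReal m' w x) =
        ∏ i, √(gaussianPDFReal (m i) (v i).toNNReal (x i) *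
          gaussianPDFReal (m' i) (w i).toNNReal (x i)) := fun x => by
      rw [gaussianPiPDFReal, gaussianPiPDFReal, ← Finset.prod_mul_distrib]
      exact Real.sqrt_prod _ fun i _ =>
        mul_nonneg (gaussianPDFReal_nonneg _ _ _) (gaussianPDFReal_nonneg _ _ _)
    simp_rw [h]
    rw [integral_fintype_prod_volume_eq_prod fun i x => √(gaussianPDFReal (m i) (v i).toNNReal x *
          gaussianPDFReal (m' i) (w i).toNNReal x)]
    simp_rw [integral_sqrt_gaussianPDFReal_mul (hv _) (hw _)]
    rw [← Real.exp_sum, covGap_diagonal hv hw, ← Finset.sum_add_distrib, Finset.sum_neg_distrib]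
  rw [← hB]
  -- The set inequality at `A = ∅` already says that the affinity is at most 1.
  have hpos : 0 ≤ 2 * (1 - ∫ x, √(gaussianPiPDFReal m v x * gaussianPiPDFReal m' w x)) := by
    simpa using sq_setIntegral_sub_le (integrable_gaussianPiPDFReal m v)
      (integrable_gaussianPiPDFReal m' w) (gaussianPiPDFReal_nonneg m v)
      (gaussianPiPDFReal_nonneg m' w) (integral_gaussianPiPDFReal m hv)
      (integral_gaussianPiPDFReal m' hw) (A := ∅) .empty
  rw [← Real.le_sqrt (tvDist_nonneg _ _) hpos]
  refine tvDist_le fun A hA => Real.le_sqrt_of_sq_le ?_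
  have hA' : MeasurableSet (WithLp.toLp 2 ⁻¹' A : Set (ι → ℝ)) := hA.preimage (by fun_prop)
  rw [sq_abs, multivariateGaussian_diagonal m fun i => (hv i).le,
    multivariateGaussian_diagonal m' fun i => (hw i).le,
    map_measureReal_apply (by fun_prop) hA, map_measureReal_apply (by fun_prop) hA,
    measureReal_pi_gaussianReal _ hv hA', measureReal_pi_gaussianReal _ hw hA']
  exact sq_setIntegral_sub_le (integrable_gaussianPiPDFReal m v)
    (integrable_gaussianPiPDFReal m' w) (gaussianPiPDFReal_nonneg m v)
    (gaussianPiPDFReal_nonneg m' w) (integral_gaussianPiPDFReal m hv)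
    (integral_gaussianPiPDFReal m' hw) hA'

end GaussianAffinity

/-! ### Half-space tests for a shift of the mean. -/

section HalfSpace

/-- The reflection `x ↦ 2m - x` preserves the law, and the point `m` is null. -/
lemma measureReal_gaussianReal_Ici_mean (m : ℝ) {v : NNReal} (hv : v ≠ 0) :
    (gaussianReal m v).real (Set.Ici m) = 1 / 2 := by
  have := nullSingletonClass_gaussianReal (μ := m) hv
  have h1 : (gaussianReal m v).real (Set.Ici m) = (gaussianReal m v).real (Set.Iic m) := by
    have hmap := gaussianReal_map_const_sub (μ := m) (v := v) (2 * m)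
    rw [show 2 * m - m = m by ring] at hmap
    conv_lhs => rw [← hmap]
    rw [map_measureReal_apply (by fun_prop) measurableSet_Ici]
    congr 1
    ext x
    simp only [Set.mem_preimage, Set.mem_Ici, Set.mem_Iic]
    constructor <;> intro h <;> linarith
  have h2 : (gaussianReal m v).real (Set.Iic m) = (gaussianReal m v).real (Set.Iio m) :=
    measureReal_congr Iio_ae_eq_Iic.symm
  have h3 := measureReal_compl (μ := gaussianReal m v) (measurableSet_Ici (a := m))
  rw [Set.compl_Ici, probReal_univ] at h3
  linarith

/-- The strip `[m, m + h)` is removed from a half-line of mass 1/2, and the density there is at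
least its value at distance `h`. Keeping `h` separate from `D` lets a large shift be truncated. -/
lemma measureReal_gaussianReal_Ici_le (m : ℝ) {v h D : ℝ} (hv : 0 < v) (hh : 0 ≤ h)
    (hD : h ≤ D) :
    (gaussianReal m v.toNNReal).real (Set.Ici (m + D)) ≤
      1 / 2 - h * ((√(2 * Real.pi * v))⁻¹ * Real.exp (-h ^ 2 / (2 * v))) := by
  have hv' : v.toNNReal ≠ 0 := by simpa using hv
  have hlow : h * ((√(2 * Real.pi * v))⁻¹ * Real.exp (-h ^ 2 / (2 * v))) ≤
      (gaussianReal m v.toNNReal).real (Set.Ico m (m + h)) := by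
    rw [Measure.real, gaussianReal_apply_eq_integral m hv', ENNReal.toReal_ofReal
      (integral_nonneg fun x => gaussianPDFReal_nonneg _ _ _)]
    have hc : ∫ _ in Set.Ico m (m + h), ((√(2 * Real.pi * v))⁻¹ * Real.exp (-h ^ 2 / (2 * v))) =
        h * ((√(2 * Real.pi * v))⁻¹ * Real.exp (-h ^ 2 / (2 * v))) := by
      rw [setIntegral_const, Real.volume_real_Ico_of_le (by linarith)]
      simp
    rw [← hc]
    refine setIntegral_mono_on (integrableOn_const (by simp))
      (integrable_gaussianPDFReal _ _).integrableOn measurableSet_Ico fun x hx => ?_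
    rw [gaussianPDFReal, Real.coe_toNNReal _ hv.le]
    have : (x - m) ^ 2 ≤ h ^ 2 := by
      have := hx.1; have := hx.2
      exact pow_le_pow_left₀ (by linarith) (by linarith) 2
    gcongr
  have hunion : (gaussianReal m v.toNNReal).real (Set.Ico m (m + h)) +
      (gaussianReal m v.toNNReal).real (Set.Ici (m + D)) ≤ 1 / 2 := by
    rw [← measureReal_gaussianReal_Ici_mean m hv', ← measureReal_union _ measurableSet_Ici]
    · refine measureReal_mono (Set.union_subset Set.Ico_subset_Ici_self ?_)
      exact Set.Ici_subset_Ici.2 (by linarith)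
    · refine Set.disjoint_left.2 fun x hx hx' => ?_
      have := hx.2; have := Set.mem_Ici.1 hx'
      linarith
  linarith

variable {ι : Type*} [Fintype ι] [DecidableEq ι]

lemma map_inner_multivariateGaussian_diagonal (m t : EuclideanSpace ℝ ι) {v : ι → ℝ}
    (hv : ∀ i, 0 ≤ v i) :
    (multivariateGaussian m (Matrix.diagonal v)).map (fun x => inner ℝ t x) =
      gaussianReal (inner ℝ t m) (∑ i, v i * t i ^ 2).toNNReal := by
  have h := IsGaussian.map_eq_gaussianReal (μ := multivariateGaussian m (Matrix.diagonal v))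
    (innerSL ℝ t)
  have hmean := (innerSL ℝ t).integral_comp_id_comm
    (IsGaussian.integrable_id (μ := multivariateGaussian m (Matrix.diagonal v)))
  have hvar := covarianceBilin_self
    (IsGaussian.memLp_two_id (μ := multivariateGaussian m (Matrix.diagonal v))) t
  rw [covarianceBilin_multivariateGaussian (Matrix.PosSemidef.diagonal hv)] at hvar
  rw [hmean, integral_id_multivariateGaussian] at h
  have hs : dotProduct t.ofLp ((Matrix.diagonal v).mulVec t.ofLp) = ∑ i, v i * t i ^ 2 := by
    simp only [dotProduct, Matrix.mulVec_diagonal]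
    exact Finset.sum_congr rfl fun i _ => by ring
  rw [hs] at hvar
  rw [hvar]
  exact h

/-- A half-space test bounds the total variation distance of two Gaussians with diagonal
covariance from below by the distance of their means. -/
theorem le_tvDist_multivariateGaussian {a b : ℝ} (ha : 0 < a) (hab : a ≤ b)
    (m m' : EuclideanSpace ℝ ι) {v w : ι → ℝ} (hv : ∀ i, 0 < v i) (hw : ∀ i, 0 < w i)
    (hlow : a * ‖m - m'‖ ^ 2 ≤ ∑ i, w i * (m - m') i ^ 2)
    (hupp : ∑ i, w i * (m - m') i ^ 2 ≤ b * ‖m - m'‖ ^ 2) :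
    (√(2 * Real.pi * b))⁻¹ * Real.exp (-1 / (2 * a)) * min 1 ‖m - m'‖ ≤
      tvDist (multivariateGaussian m (Matrix.diagonal v))
        (multivariateGaussian m' (Matrix.diagonal w)) := by
  set t := m - m' with ht
  rcases eq_or_ne t 0 with h0 | h0
  · simpa [h0] using tvDist_nonneg _ _
  have hn : 0 < ‖t‖ := norm_pos_iff.2 h0
  have hb : 0 < b := ha.trans_le hab
  set W := ∑ i, w i * t i ^ 2 with hW
  have hW0 : 0 < W := lt_of_lt_of_le (by positivity) hlow
  have hV0 : 0 < ∑ i, v i * t i ^ 2 := by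
    obtain ⟨i, hi⟩ : ∃ i, t i ≠ 0 := by
      by_contra! h
      exact h0 (by ext i; simpa using h i)
    exact Finset.sum_pos' (fun i _ => mul_nonneg (hv i).le (sq_nonneg _))
      ⟨i, Finset.mem_univ i, mul_pos (hv i) (by positivity)⟩
  set n := ‖t‖
  -- Along the unnormalised direction `t` the projected means differ by `n²`, with standard
  -- deviation of order `n`. Truncating the gap so that `h ≤ n` keeps the exponential above
  -- `e^(-1/(2a))`.
  set h := n * min 1 n with hh
  have hmin : 0 < min 1 n := lt_min one_pos hn
  have hmean : inner ℝ t m = inner ℝ t m' + n ^ 2 := by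
    rw [← real_inner_self_eq_norm_sq, ← inner_add_right, ht, add_sub_cancel]
  have hA : MeasurableSet {x : EuclideanSpace ℝ ι | inner ℝ t m ≤ inner ℝ t x} :=
    measurableSet_le measurable_const (by fun_prop)
  have e1 : (multivariateGaussian m (Matrix.diagonal v)).real
      {x | inner ℝ t m ≤ inner ℝ t x} = 1 / 2 := by
    have := measureReal_gaussianReal_Ici_mean (inner ℝ t m)
      (v := (∑ i, v i * t i ^ 2).toNNReal) (by simpa using hV0)
    rwa [← map_inner_multivariateGaussian_diagonal m t fun i => (hv i).le,
      map_measureReal_apply (by fun_prop) measurableSet_Ici] at this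
  have e2 : (multivariateGaussian m' (Matrix.diagonal w)).real
      {x | inner ℝ t m ≤ inner ℝ t x} ≤
        1 / 2 - h * ((√(2 * Real.pi * W))⁻¹ * Real.exp (-h ^ 2 / (2 * W))) := by
    have := measureReal_gaussianReal_Ici_le (inner ℝ t m') (h := h) (D := n ^ 2) hW0
      (by positivity) (by rw [hh, sq]; gcongr; exact min_le_right _ _)
    rwa [← map_inner_multivariateGaussian_diagonal m' t fun i => (hw i).le, ← hmean,
      map_measureReal_apply (by fun_prop) measurableSet_Ici] at this
  have e3 := (le_abs_self _).trans (abs_measureReal_sub_le_tvDist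
    (multivariateGaussian m (Matrix.diagonal v)) (multivariateGaussian m' (Matrix.diagonal w)) hA)
  refine le_trans ?_ ((sub_le_sub e1.ge e2).trans e3)
  have hexp : -1 / (2 * a) ≤ -h ^ 2 / (2 * W) := by
    rw [neg_div, neg_div, neg_le_neg_iff, div_le_div_iff₀ (by positivity) (by positivity)]
    have : h ^ 2 ≤ n ^ 2 := by
      refine pow_le_pow_left₀ (by positivity) ?_ 2
      exact mul_le_of_le_one_right hn.le (min_le_left _ _)
    nlinarith
  have hsq : (√(2 * Real.pi * b))⁻¹ ≤ n * (√(2 * Real.pi * W))⁻¹ := by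
    rw [← div_eq_mul_inv, le_div_iff₀ (by positivity), ← div_eq_inv_mul,
      div_le_iff₀ (by positivity)]
    refine Real.sqrt_le_iff.2 ⟨by positivity, ?_⟩
    rw [mul_pow, Real.sq_sqrt (by positivity)]
    nlinarith [Real.pi_pos]
  calc _ ≤ (n * (√(2 * Real.pi * W))⁻¹) * Real.exp (-h ^ 2 / (2 * W)) * min 1 n := by gcongr
    _ = _ := by rw [hh]; ring

end HalfSpace

/-! ### Sparsification: the exponent of one client. -/

section Sparsification

variable {q r : ℕ}

lemma blockCov_eq_diagonal (v : Fin q → ℝ) (w : Fin r → ℝ) :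
    blockCov v w = Matrix.diagonal (Sum.elim v w) :=
  Matrix.fromBlocks_diagonal v w

instance isProbabilityMeasure_blockGaussian (μ₁ : EuclideanSpace ℝ (Fin q))
    (μ₂ : EuclideanSpace ℝ (Fin r)) (v : Fin q → ℝ) (w : Fin r → ℝ) :
    IsProbabilityMeasure (blockGaussian μ₁ μ₂ v w) := by
  unfold blockGaussian
  infer_instance

/-- The means agree on the shared block, so the variance in their difference direction involves only
`sg`; the shared variances need no uniform bounds. -/
theorem le_tvDist_blockGaussian {a b : ℝ} (ha : 0 < a) (hab : a ≤ b)
    (μu : EuclideanSpace ℝ (Fin q)) (μo μg : EuclideanSpace ℝ (Fin r)) {su : Fin q → ℝ}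
    {so sg : Fin r → ℝ} (hu : ∀ i, 0 < su i) (ho : ∀ i, so i ∈ Set.Icc a b)
    (hg : ∀ i, sg i ∈ Set.Icc a b) :
    (√(2 * Real.pi * b))⁻¹ * Real.exp (-1 / (2 * a)) * min 1 ‖μo - μg‖ ≤
      tvDist (blockGaussian μu μo su so) (blockGaussian μu μg su sg) := by
  have hv : ∀ i, 0 < Sum.elim su so i := by
    rintro (i | i)
    exacts [hu i, ha.trans_le (ho i).1]
  have hw : ∀ i, 0 < Sum.elim su sg i := by
    rintro (i | i)
    exacts [hu i, ha.trans_le (hg i).1]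
  have hnorm : ‖(WithLp.toLp 2 (Sum.elim μu μo) - WithLp.toLp 2 (Sum.elim μu μg) :
      EuclideanSpace ℝ (Fin q ⊕ Fin r))‖ = ‖μo - μg‖ := by
    simp [EuclideanSpace.norm_eq]
  have := le_tvDist_multivariateGaussian ha hab (WithLp.toLp 2 (Sum.elim μu μo))
    (WithLp.toLp 2 (Sum.elim μu μg)) hv hw ?_ ?_
  · rwa [hnorm, ← blockCov_eq_diagonal, ← blockCov_eq_diagonal] at this
  · rw [hnorm, EuclideanSpace.real_norm_sq_eq, Finset.mul_sum]
    simp only [Fintype.sum_sum_type, PiLp.sub_apply, Sum.elim_inl, Sum.elim_inr, sub_self]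
    simp only [ne_eq, OfNat.ofNat_ne_zero, not_false_eq_true, zero_pow, mul_zero,
      Finset.sum_const_zero, zero_add]
    exact Finset.sum_le_sum fun i _ => mul_le_mul_of_nonneg_right (hg i).1 (sq_nonneg _)
  · rw [hnorm, EuclideanSpace.real_norm_sq_eq, Finset.mul_sum]
    simp only [Fintype.sum_sum_type, PiLp.sub_apply, Sum.elim_inl, Sum.elim_inr, sub_self]
    simp only [ne_eq, OfNat.ofNat_ne_zero, not_false_eq_true, zero_pow, mul_zero,
      Finset.sum_const_zero, zero_add]
    exact Finset.sum_le_sum fun i _ => mul_le_mul_of_nonneg_right (hg i).2 (sq_nonneg _)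

lemma covGap_blockCov_nonneg {su : Fin q → ℝ} {so sg : Fin r → ℝ} (hu : ∀ i, 0 < su i)
    (ho : ∀ i, 0 < so i) (hg : ∀ i, 0 < sg i) :
    0 ≤ covGap (blockCov su so) (blockCov su sg) := by
  have hv : ∀ i, 0 < Sum.elim su so i := by
    rintro (i | i)
    exacts [hu i, ho i]
  have hw : ∀ i, 0 < Sum.elim su sg i := by
    rintro (i | i)
    exacts [hu i, hg i]
  rw [blockCov_eq_diagonal, blockCov_eq_diagonal, covGap_diagonal hv hw]
  exact Finset.sum_nonneg fun i _ => varGap_nonneg (hv i) (hw i)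

theorem sq_tvDist_blockGaussian_le {a : ℝ} (ha : 0 < a)
    (μu : EuclideanSpace ℝ (Fin q)) (μo μg : EuclideanSpace ℝ (Fin r)) {su : Fin q → ℝ}
    {so sg : Fin r → ℝ} (hu : ∀ i, 0 < su i) (ho : ∀ i, a ≤ so i) (hg : ∀ i, a ≤ sg i) :
    tvDist (blockGaussian μu μo su so) (blockGaussian μu μg su sg) ^ 2 ≤
      2 * (1 - Real.exp (-(covGap (blockCov su so) (blockCov su sg) +
        1 / (8 * a) * ‖μo - μg‖ ^ 2))) := by
  have hv : ∀ i, 0 < Sum.elim su so i := by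
    rintro (i | i)
    exacts [hu i, ha.trans_le (ho i)]
  have hw : ∀ i, 0 < Sum.elim su sg i := by
    rintro (i | i)
    exacts [hu i, ha.trans_le (hg i)]
  have h := sq_tvDist_multivariateGaussian_le (WithLp.toLp 2 (Sum.elim μu μo))
    (WithLp.toLp 2 (Sum.elim μu μg)) hv hw
  rw [← blockCov_eq_diagonal, ← blockCov_eq_diagonal] at h
  refine h.trans ?_
  gcongr
  rw [EuclideanSpace.real_norm_sq_eq, Finset.mul_sum]
  simp only [Fintype.sum_sum_type, PiLp.sub_apply, Sum.elim_inl, Sum.elim_inr, sub_self]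
  simp only [ne_eq, OfNat.ofNat_ne_zero, not_false_eq_true, zero_pow, zero_div,
    Finset.sum_const_zero, zero_add]
  refine Finset.sum_le_sum fun i _ => ?_
  rw [div_eq_mul_one_div, mul_comm]
  refine mul_le_mul_of_nonneg_right (one_div_le_one_div_of_le (by positivity) ?_) (sq_nonneg _)
  linarith [ho i, hg i]

/-- Representation of the total variation distance of one client as `√2 (1 - e^{-f})^{1/2}`. -/
theorem exists_hellinger_exponent {a b : ℝ} (ha : 0 < a) (hab : a ≤ b)
    (μu : EuclideanSpace ℝ (Fin q)) (μo μg : EuclideanSpace ℝ (Fin r)) {su : Fin q → ℝ}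
    {so sg : Fin r → ℝ} (hu : ∀ i, 0 < su i) (ho : ∀ i, so i ∈ Set.Icc a b)
    (hg : ∀ i, sg i ∈ Set.Icc a b) :
    ∃ f : ℝ,
      ((√(2 * Real.pi * b))⁻¹ * Real.exp (-1 / (2 * a))) ^ 2 / 2 * min 1 (‖μo - μg‖ ^ 2) ≤ f ∧
      f ≤ covGap (blockCov su so) (blockCov su sg) + (1 / (8 * a) + 1) * ‖μo - μg‖ ^ 2 ∧
      f ≤ covGap (blockCov su so) (blockCov su sg) + (1 / (8 * a) + 1) * ‖μo - μg‖ ∧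
      tvDist (blockGaussian μu μo su so) (blockGaussian μu μg su sg) =
        √2 * √(1 - Real.exp (-f)) := by
  set T := tvDist (blockGaussian μu μo su so) (blockGaussian μu μg su sg)
  set n := ‖μo - μg‖
  set δ := covGap (blockCov su so) (blockCov su sg)
  have hn : 0 ≤ n := norm_nonneg _
  have hT0 : 0 ≤ T := tvDist_nonneg _ _
  have hT1 : T ≤ 1 := tvDist_le_one _ _
  have hδ : 0 ≤ δ := covGap_blockCov_nonneg hu (fun i => ha.trans_le (ho i).1)
    fun i => ha.trans_le (hg i).1
  have hlow := le_tvDist_blockGaussian ha hab μu μo μg hu ho hg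
  have hupp := sq_tvDist_blockGaussian_le ha μu μo μg hu (fun i => (ho i).1) fun i => (hg i).1
  have hT2 : T ^ 2 ≤ 1 := pow_le_one₀ hT0 hT1
  have hpos : 0 < 1 - T ^ 2 / 2 := by linarith
  have hf : -Real.log (1 - T ^ 2 / 2) ≤ δ + 1 / (8 * a) * n ^ 2 := by
    rw [neg_le, Real.le_log_iff_exp_le hpos]
    linarith
  have ha8 : 0 < 1 / (8 * a) := by positivity
  -- The only exponent solving the required identity; it is defined because `T ≤ 1`.
  refine ⟨-Real.log (1 - T ^ 2 / 2), ?_, ?_, ?_, ?_⟩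
  · have hlog := Real.log_le_sub_one_of_pos hpos
    have hsq := pow_le_pow_left₀ (by positivity) hlow 2
    have hmin : (min 1 n) ^ 2 = min 1 (n ^ 2) := by
      rcases le_total 1 n with h | h
      · rw [min_eq_left h, min_eq_left (one_le_pow₀ h), one_pow]
      · rw [min_eq_right h, min_eq_right (pow_le_one₀ hn h)]
    rw [mul_pow, hmin] at hsq
    linarith
  · nlinarith [sq_nonneg n]
  · rcases le_total n 1 with h | h
    · nlinarith [mul_le_mul_of_nonneg_left h hn]
    -- For `n ≥ 1` the bound `T ≤ 1` alone gives `f ≤ 1 ≤ n`, which is paid for by the `+ 1` in the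
    -- constant.
    · have hlog : -Real.log (1 - T ^ 2 / 2) ≤ 1 := by
        rw [← Real.log_inv]
        have : (1 - T ^ 2 / 2)⁻¹ ≤ 2 := by
          rw [inv_le_comm₀ hpos two_pos]
          linarith
        exact (Real.log_le_sub_one_of_pos (inv_pos.2 hpos)).trans (by linarith)
      nlinarith
  · rw [neg_neg, Real.exp_log hpos, ← Real.sqrt_mul zero_le_two,
      show 2 * (1 - (1 - T ^ 2 / 2)) = T ^ 2 by ring, Real.sqrt_sq hT0]

end Sparsification

/-! ### Logarithmic concentration of the chi-squared law. -/

section ChiSquared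

/-- Distribution function of the chi-squared law with `d` degrees of freedom. -/
noncomputable def chiSquaredCDF (d : ℕ) (u : ℝ) : ℝ :=
  (Measure.pi fun _ : Fin d => gaussianReal 0 1).real {z | ∑ i, z i ^ 2 ≤ u}

lemma measurableSet_sum_sq_le (d : ℕ) (u : ℝ) :
    MeasurableSet {z : Fin d → ℝ | ∑ i, z i ^ 2 ≤ u} :=
  measurableSet_le (by fun_prop) measurable_const

lemma chiSquaredCDF_mono (d : ℕ) : Monotone (chiSquaredCDF d) := fun _ _ h =>
  measureReal_mono fun _ hz => le_trans (Set.mem_ofPred.1 hz) h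

lemma measureReal_sum_sq_mem_Ioc (d : ℕ) (l u : ℝ) (hlu : l ≤ u) :
    (Measure.pi fun _ : Fin d => gaussianReal 0 1).real
      {z | l < ∑ i, z i ^ 2 ∧ ∑ i, z i ^ 2 ≤ u} = chiSquaredCDF d u - chiSquaredCDF d l := by
  rw [chiSquaredCDF, chiSquaredCDF, ← measureReal_sdiff _ (measurableSet_sum_sq_le d l)]
  · congr 1
    ext z
    simp [and_comm]
  · exact fun z hz => le_trans (Set.mem_ofPred.1 hz) hlu

/-- Chebyshev's inequality for the chi-squared law. -/
lemma exists_chiSquared_concentration : ∃ k : ℝ, 0 < k ∧ ∀ d : ℕ, 0 < d →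
    1 / 2 ≤ chiSquaredCDF d (d + k * √d) - chiSquaredCDF d (d - k * √d) := by
  set V := Var[fun x : ℝ => x ^ 2; gaussianReal 0 1] with hV
  have hV0 : 0 ≤ V := variance_nonneg _ _
  have hmem : MemLp (fun x : ℝ => x ^ 2) 2 (gaussianReal 0 1) := by
    have h4 : MemLp (id : ℝ → ℝ) (4 : ℕ) (gaussianReal 0 1) := memLp_id_gaussianReal' _ (by simp)
    rw [memLp_two_iff_integrable_sq (by fun_prop)]
    refine (h4.integrable_norm_pow (by norm_num)).congr (.of_forall fun x => ?_)
    simp only [id_eq, Real.norm_eq_abs]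
    rw [← pow_mul, Even.pow_abs (by decide)]
  have hint : ∫ x : ℝ, x ^ 2 ∂(gaussianReal 0 1) = 1 := by
    have := variance_fun_id_gaussianReal (μ := 0) (v := 1)
    rw [variance_eq_integral (by fun_prop)] at this
    simpa using this
  -- Chebyshev's bound is then `V / k² ≤ 1/2`, and the `+ 1` keeps `k` positive.
  refine ⟨√(2 * V + 1), by positivity, fun d hd => ?_⟩
  set k := √(2 * V + 1) with hk
  have hk2 : k ^ 2 = 2 * V + 1 := Real.sq_sqrt (by positivity)
  have hk0 : 0 < k := by positivity
  have hd0 : (0 : ℝ) < d := by exact_mod_cast hd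
  set γ := Measure.pi fun _ : Fin d => gaussianReal 0 1 with hγ
  have hX : ∀ i : Fin d, MemLp (fun z : Fin d → ℝ => z i ^ 2) 2 γ := fun i =>
    hmem.comp_measurePreserving (measurePreserving_eval (fun _ : Fin d => gaussianReal 0 1) i)
  have hXs : MemLp (∑ i : Fin d, fun z : Fin d → ℝ => z i ^ 2) 2 γ :=
    memLp_finsetSum' _ fun i _ => hX i
  have hvar : Var[∑ i : Fin d, fun z : Fin d → ℝ => z i ^ 2; γ] = d * V := by
    rw [variance_sum_pi (X := fun _ x => x ^ 2) fun _ => hmem]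
    simp [hV]
  have hmean : ∫ z, (∑ i : Fin d, fun z : Fin d → ℝ => z i ^ 2) z ∂γ = (d : ℝ) := by
    simp only [Finset.sum_apply]
    rw [integral_finsetSum _ fun i _ => (hX i).integrable one_le_two]
    have : ∀ i : Fin d, ∫ z, z i ^ 2 ∂γ = 1 := fun i => by
      rw [← hint, ← (measurePreserving_eval (fun _ : Fin d => gaussianReal 0 1) i).map_eq,
        integral_map (measurable_pi_apply i).aemeasurable (by fun_prop)]
    simp [this]
  have hcheb := meas_ge_le_variance_div_sq hXs (c := k * √d) (by positivity)
  rw [hvar, hmean, mul_pow, Real.sq_sqrt hd0.le] at hcheb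
  have hcheb' : γ.real {z | k * √d ≤ |(∑ i : Fin d, fun z : Fin d → ℝ => z i ^ 2) z - d|}
      ≤ 1 / 2 := by
    refine (ENNReal.toReal_mono ENNReal.ofReal_ne_top hcheb).trans ?_
    rw [ENNReal.toReal_ofReal (by positivity), div_le_div_iff₀ (by positivity) two_pos]
    nlinarith
  rw [← measureReal_sum_sq_mem_Ioc d _ _ (by nlinarith [Real.sqrt_nonneg (d : ℝ)])]
  have hms : MeasurableSet {z : Fin d → ℝ | k * √d ≤
      |(∑ i : Fin d, fun z : Fin d → ℝ => z i ^ 2) z - d|} := by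
    simp only [Finset.sum_apply]
    exact measurableSet_le measurable_const (by fun_prop)
  have hcompl := probReal_compl_eq_one_sub (μ := γ) hms
  calc (1 / 2 : ℝ) ≤ γ.real {z | k * √d ≤
        |(∑ i : Fin d, fun z : Fin d → ℝ => z i ^ 2) z - d|}ᶜ := by rw [hcompl]; linarith
    _ ≤ _ := by
      refine measureReal_mono fun z hz => ?_
      simp only [Finset.sum_apply, Set.mem_compl_iff, Set.mem_ofPred_eq, not_le, abs_lt] at hz ⊢
      constructor <;> linarith [hz.1, hz.2]

lemma chiSquaredCDF_zero {d : ℕ} (hd : 0 < d) : chiSquaredCDF d 0 = 0 := by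
  have := nullSingletonClass_gaussianReal (μ := 0) (v := 1) one_ne_zero
  have hsub : {z : Fin d → ℝ | ∑ i, z i ^ 2 ≤ 0} ⊆ (fun z => z ⟨0, hd⟩) ⁻¹' {0} := by
    intro z hz
    have h0 := (Finset.sum_eq_zero_iff_of_nonneg fun i _ => sq_nonneg (z i)).1
      (le_antisymm hz (Finset.sum_nonneg fun i _ => sq_nonneg (z i))) ⟨0, hd⟩ (Finset.mem_univ _)
    simpa using h0
  have h0 : (Measure.pi fun _ : Fin d => gaussianReal 0 1).real
      ((fun z => z ⟨0, hd⟩) ⁻¹' {0}) = 0 := by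
    have := (measurePreserving_eval (fun _ : Fin d => gaussianReal 0 1)
      ⟨0, hd⟩).measureReal_preimage (measurableSet_singleton (0 : ℝ)).nullMeasurableSet
    refine Eq.trans this ?_
    simp [Measure.real]
  exact le_antisymm ((measureReal_mono hsub).trans h0.le) measureReal_nonneg

/-- Exhaustion of `(0, ∞)`, which has full mass for `d > 0`. It serves the finitely many small `d`
where the Chebyshev interval may reach 0. -/
lemma exists_chiSquaredCDF_sub_ge {d : ℕ} (hd : 0 < d) :
    ∃ l R : ℝ, 0 < l ∧ 1 ≤ R ∧ 1 / 2 ≤ chiSquaredCDF d (l * R) - chiSquaredCDF d l := by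
  set γ := Measure.pi fun _ : Fin d => gaussianReal 0 1 with hγ
  let S : ℕ → Set (Fin d → ℝ) := fun n =>
    {z | 1 / ((n : ℝ) + 1) < ∑ i, z i ^ 2 ∧ ∑ i, z i ^ 2 ≤ n + 1}
  have hmono : Monotone S := by
    intro n n' h z hz
    have hn : (n : ℝ) ≤ n' := by exact_mod_cast h
    exact ⟨(one_div_le_one_div_of_le (by positivity) (by linarith)).trans_lt hz.1,
      hz.2.trans (by linarith)⟩
  have hunion : ⋃ n, S n = {z | ∑ i, z i ^ 2 ≤ 0}ᶜ := by
    ext z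
    simp only [Set.mem_iUnion, Set.mem_compl_iff, Set.mem_ofPred_eq, not_le, S]
    constructor
    · rintro ⟨n, hn, -⟩
      exact lt_trans (by positivity) hn
    · intro hz
      obtain ⟨n₁, h₁⟩ := exists_nat_one_div_lt hz
      obtain ⟨n₂, h₂⟩ := exists_nat_ge (∑ i, z i ^ 2)
      refine ⟨max n₁ n₂, lt_of_le_of_lt (one_div_le_one_div_of_le (by positivity) ?_) h₁,
        h₂.trans ?_⟩
      · push_cast
        linarith [le_max_left (n₁ : ℝ) n₂]
      · push_cast
        linarith [le_max_right (n₁ : ℝ) n₂]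
  have hone : γ (⋃ n, S n) = 1 := by
    rw [hunion, prob_compl_eq_one_iff (measurableSet_sum_sq_le d 0)]
    exact (measureReal_eq_zero_iff).1 (chiSquaredCDF_zero hd)
  have htend := tendsto_measure_iUnion_atTop (μ := γ) hmono
  rw [hone] at htend
  obtain ⟨n, hn⟩ := (htend.eventually (lt_mem_nhds (show ENNReal.ofReal (1 / 2) < 1 by
    rw [← ENNReal.ofReal_one]
    exact (ENNReal.ofReal_lt_ofReal_iff one_pos).2 (by norm_num)))).exists
  have hn' : 1 / 2 ≤ γ.real (S n) :=
    (ENNReal.ofReal_le_iff_le_toReal (measure_ne_top _ _)).1 hn.le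
  have h1 : (1 : ℝ) ≤ (n : ℝ) + 1 := by linarith [n.cast_nonneg (α := ℝ)]
  refine ⟨1 / ((n : ℝ) + 1), ((n : ℝ) + 1) ^ 2, by positivity, one_le_pow₀ h1, ?_⟩
  have e : 1 / ((n : ℝ) + 1) * ((n : ℝ) + 1) ^ 2 = n + 1 := by field_simp
  rw [e, ← measureReal_sum_sq_mem_Ioc d _ _ ?_]
  · exact hn'
  · exact (div_le_one (by positivity)).2 h1 |>.trans h1

/-- A fixed proportion of the chi-squared law lies in an interval whose logarithm has length
of order `1 / √d`. -/
lemma exists_chiSquared_log_width : ∃ L : ℝ, 0 < L ∧ ∀ d : ℕ, 0 < d → ∃ l : ℝ, 0 < l ∧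
    1 / 2 ≤ chiSquaredCDF d (l * Real.exp (L / √d)) - chiSquaredCDF d l := by
  obtain ⟨k, hk, hconc⟩ := exists_chiSquared_concentration
  have hsmall : ∀ N : ℕ, ∃ L : ℝ, 0 < L ∧ ∀ d : ℕ, 0 < d → d < N → ∃ l : ℝ, 0 < l ∧
      1 / 2 ≤ chiSquaredCDF d (l * Real.exp (L / √d)) - chiSquaredCDF d l := by
    intro N
    induction N with
    | zero => exact ⟨1, one_pos, fun d _ h => absurd h (by omega)⟩
    | succ N ih =>
      obtain ⟨L, hL, ih⟩ := ih
      rcases Nat.eq_zero_or_pos N with rfl | hN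
      · exact ⟨1, one_pos, fun d _ h => absurd h (by omega)⟩
      obtain ⟨l, R, hl, hR, hlR⟩ := exists_chiSquaredCDF_sub_ge hN
      -- The second entry makes `exp (L / √N) ≥ R`.
      refine ⟨max L (√N * Real.log R), lt_max_of_lt_left hL, fun d hd hdN => ?_⟩
      rcases Nat.lt_succ_iff_lt_or_eq.1 hdN with h | rfl
      · obtain ⟨l, hl, h⟩ := ih d hd h
        refine ⟨l, hl, h.trans (sub_le_sub_right (chiSquaredCDF_mono d ?_) _)⟩
        gcongr
        exact le_max_left _ _
      · have hs : 0 < √(d : ℝ) := Real.sqrt_pos.2 (by exact_mod_cast hd)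
        refine ⟨l, hl, hlR.trans (sub_le_sub_right (chiSquaredCDF_mono d ?_) _)⟩
        gcongr
        rw [← Real.log_le_iff_le_exp (by linarith), le_div_iff₀ hs, mul_comm]
        exact le_max_right _ _
  obtain ⟨L, hL, hsmall⟩ := hsmall (⌈4 * k ^ 2⌉₊)
  -- For `√d ≥ 2k` the Chebyshev interval starts at `d - k√d > 0`, and its endpoints have ratio at
  -- most `1 + 4k/√d`.
  refine ⟨max L (4 * k), lt_max_of_lt_left hL, fun d hd => ?_⟩
  have hs : 0 < √(d : ℝ) := Real.sqrt_pos.2 (by exact_mod_cast hd)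
  rcases lt_or_ge d ⌈4 * k ^ 2⌉₊ with h | h
  · obtain ⟨l, hl, h⟩ := hsmall d hd h
    refine ⟨l, hl, h.trans (sub_le_sub_right (chiSquaredCDF_mono d ?_) _)⟩
    gcongr
    exact le_max_left _ _
  · have hd4 : 2 * k ≤ √(d : ℝ) := by
      refine Real.le_sqrt_of_sq_le ?_
      have := Nat.ceil_le.1 h
      linarith
    have hsq : √(d : ℝ) ^ 2 = d := Real.sq_sqrt (by positivity)
    set s := √(d : ℝ)
    have hl : 0 < (d : ℝ) - k * s := by nlinarith
    refine ⟨d - k * s, hl, (hconc d hd).trans (sub_le_sub_right (chiSquaredCDF_mono d ?_) _)⟩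
    have hexp : 1 + 4 * (k / s) ≤ Real.exp (max L (4 * k) / s) := by
      refine le_trans ?_ (Real.exp_le_exp.2 (div_le_div_of_nonneg_right (le_max_right _ _) hs.le))
      have := Real.add_one_le_exp (4 * k / s)
      rw [mul_div_assoc] at this ⊢
      linarith
    refine le_trans ?_ (mul_le_mul_of_nonneg_left hexp hl.le)
    have e : (s ^ 2 - k * s) * (1 + 4 * (k / s)) = s ^ 2 + 3 * k * s - 4 * k ^ 2 := by
      field_simp
      ring
    rw [hsq] at e
    rw [e]
    nlinarith

end ChiSquared

/-! ### Randomization: concentric isotropic Gaussians. -/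

section Randomization

variable {d : ℕ}

lemma isoGaussian_eq_diagonal (μ : EuclideanSpace ℝ (Fin d)) (s : ℝ) :
    isoGaussian μ s = multivariateGaussian μ (Matrix.diagonal fun _ => s ^ 2) := by
  rw [isoGaussian, Matrix.smul_one_eq_diagonal]

lemma randomize_isoGaussian (μ : EuclideanSpace ℝ (Fin d)) (s σ : ℝ) :
    randomize σ (isoGaussian μ s) =
      multivariateGaussian μ (Matrix.diagonal fun _ => s ^ 2 + σ ^ 2) := by
  rw [randomize, isoGaussian_eq_diagonal, isoGaussian_eq_diagonal]
  apply Measure.ext_of_charFun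
  ext t
  rw [charFun_conv, charFun_multivariateGaussian (Matrix.PosSemidef.diagonal fun _ => by positivity),
    charFun_multivariateGaussian (Matrix.PosSemidef.diagonal fun _ => by positivity),
    charFun_multivariateGaussian (Matrix.PosSemidef.diagonal fun _ => by positivity),
    ← Complex.exp_add]
  congr 1
  rw [← Matrix.diagonal_add, Matrix.add_mulVec, dotProduct_add, inner_zero_right]
  push_cast
  ring

lemma measureReal_multivariateGaussian_sum_sq_le (μ : EuclideanSpace ℝ (Fin d)) {v : ℝ}
    (hv : 0 < v) (u : ℝ) :
    (multivariateGaussian μ (Matrix.diagonal fun _ => v)).real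
      {x | ∑ i, (x i - μ i) ^ 2 ≤ u} = chiSquaredCDF d (u / v) := by
  have hpi : (Measure.pi fun _ : Fin d => gaussianReal 0 1).map
      (fun z i => √v * z i + μ i) = Measure.pi fun i => gaussianReal (μ i) v.toNNReal := by
    have hone : ∀ i, (gaussianReal 0 1).map (fun x => √v * x + μ i) =
        gaussianReal (μ i) v.toNNReal := fun i => by
      have : (fun x => √v * x + μ i) = (fun x => x + μ i) ∘ fun x => √v * x := rfl
      rw [this, ← Measure.map_map (by fun_prop) (by fun_prop), gaussianReal_map_const_mul,
        gaussianReal_map_add_const]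
      congr 1
      · simp
      · ext
        simp [Real.sq_sqrt hv.le, hv.le]
    have := Measure.pi_map_pi (μ := fun _ : Fin d => gaussianReal 0 1)
      (f := fun i x => √v * x + μ i) fun i => by fun_prop
    rw [this]
    simp_rw [hone]
  have hA : MeasurableSet {x : EuclideanSpace ℝ (Fin d) | ∑ i, (x i - μ i) ^ 2 ≤ u} :=
    measurableSet_le (by fun_prop) measurable_const
  rw [multivariateGaussian_diagonal μ fun _ => hv.le, map_measureReal_apply (by fun_prop) hA,
    ← hpi, map_measureReal_apply (by fun_prop) (hA.preimage (by fun_prop)), chiSquaredCDF]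
  congr 1
  ext z
  simp only [Set.mem_preimage, Set.mem_ofPred_eq, add_sub_cancel_right, mul_pow,
    Real.sq_sqrt hv.le, ← Finset.mul_sum]
  rw [le_div_iff₀ hv, mul_comm]

/-- The test is the ball of squared radius `u * ρ * v`, which rescales to level `u * ρ` under the
first law and `u` under the second. -/
lemma chiSquaredCDF_sub_le_tvDist (μ : EuclideanSpace ℝ (Fin d)) {v ρ : ℝ} (hv : 0 < v)
    (hρ : 0 < ρ) (u : ℝ) :
    chiSquaredCDF d (u * ρ) - chiSquaredCDF d u ≤
      tvDist (multivariateGaussian μ (Matrix.diagonal fun _ => v))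
        (multivariateGaussian μ (Matrix.diagonal fun _ => v * ρ)) := by
  have hA : MeasurableSet {x : EuclideanSpace ℝ (Fin d) | ∑ i, (x i - μ i) ^ 2 ≤ u * ρ * v} :=
    measurableSet_le (by fun_prop) measurable_const
  refine le_trans (le_of_eq ?_) ((le_abs_self _).trans (abs_measureReal_sub_le_tvDist _ _ hA))
  rw [measureReal_multivariateGaussian_sum_sq_le μ hv,
    measureReal_multivariateGaussian_sum_sq_le μ (mul_pos hv hρ)]
  congr 2
  · field_simp
  · field_simp

/-- Radial tests at geometrically growing radii bound the total variation distance of two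
concentric isotropic Gaussians from below. -/
theorem exists_le_tvDist_isotropic : ∃ c : ℝ, 0 < c ∧ ∀ (d : ℕ) (μ : EuclideanSpace ℝ (Fin d))
    (v s : ℝ), 0 < v → 0 ≤ s → c * min 1 (s * √d) ≤
      tvDist (multivariateGaussian μ (Matrix.diagonal fun _ => v))
        (multivariateGaussian μ (Matrix.diagonal fun _ => v * (1 + s))) := by
  obtain ⟨L, hL, hwidth⟩ := exists_chiSquared_log_width
  refine ⟨1 / (2 * (2 * L + 1)), by positivity, fun d μ v s hv hs => ?_⟩
  set T := tvDist (multivariateGaussian μ (Matrix.diagonal fun _ => v))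
    (multivariateGaussian μ (Matrix.diagonal fun _ => v * (1 + s)))
  have hT : 0 ≤ T := tvDist_nonneg _ _
  rcases Nat.eq_zero_or_pos d with rfl | hd
  · simpa using hT
  rcases hs.eq_or_lt with rfl | hs
  · simpa using hT
  obtain ⟨l, hl, hlw⟩ := hwidth d hd
  have hd1 : (1 : ℝ) ≤ √d := Real.one_le_sqrt.2 (by exact_mod_cast hd)
  have hd0 : 0 < √(d : ℝ) := by linarith
  -- Truncating `s` at 1 is harmless because `√d ≥ 1`, and it makes `log (1 + s)` comparable to `min
  -- 1 s`.
  set y := √(d : ℝ) * min 1 s with hy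
  have hm : 0 < min 1 s := lt_min one_pos hs
  have hy0 : 0 < y := by positivity
  have hxy : min 1 (s * √d) ≤ min 1 y := by
    refine le_min (min_le_left _ _) ?_
    rcases le_total 1 s with h | h
    · rw [hy, min_eq_left h, mul_one]
      exact (min_le_left _ _).trans hd1
    · rw [hy, min_eq_right h, mul_comm]
      exact min_le_right _ _
  have hlog : min 1 s / 2 ≤ Real.log (1 + s) := by
    have h1 : 1 - (1 + s)⁻¹ ≤ Real.log (1 + s) := Real.one_sub_inv_le_log_of_pos (by linarith)
    refine le_trans ?_ h1
    have e : 1 - (1 + s)⁻¹ = s / (1 + s) := by field_simp; ring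
    rw [e, div_le_div_iff₀ two_pos (by linarith)]
    rcases le_total 1 s with h | h
    · rw [min_eq_left h]; linarith
    · rw [min_eq_right h]; nlinarith
  -- Enough factors `1 + s` to cross the window: `(2L/y) * (min 1 s / 2) = L/√d`.
  obtain ⟨N, hN1, hN2⟩ : ∃ N : ℕ, 2 * L / y ≤ N ∧ (N : ℝ) ≤ 2 * L / y + 1 :=
    ⟨⌈2 * L / y⌉₊, Nat.le_ceil _, (Nat.ceil_lt_add_one (by positivity)).le⟩
  have htel : ∀ n : ℕ, chiSquaredCDF d (l * (1 + s) ^ n) - chiSquaredCDF d l ≤ n * T := by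
    intro n
    induction n with
    | zero => simp
    | succ n ih =>
      have := chiSquaredCDF_sub_le_tvDist μ hv (ρ := 1 + s) (by linarith) (l * (1 + s) ^ n)
      rw [mul_assoc, ← pow_succ] at this
      push_cast
      linarith
  have hpow : Real.exp (L / √d) ≤ (1 + s) ^ N := by
    rw [← Real.le_log_iff_exp_le (by positivity), Real.log_pow]
    calc L / √d = 2 * L / y * (min 1 s / 2) := by rw [hy]; field_simp
      _ ≤ N * Real.log (1 + s) := by gcongr
  have hhalf : 1 / 2 ≤ N * T := by
    refine (hlw.trans (sub_le_sub_right (chiSquaredCDF_mono d ?_) _)).trans (htel N)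
    gcongr
  have hNT : 1 / 2 ≤ (2 * L / y + 1) * T := hhalf.trans (by gcongr)
  have hyT : y / 2 ≤ (2 * L + y) * T := by
    have := mul_le_mul_of_nonneg_left hNT hy0.le
    have e : y * ((2 * L / y + 1) * T) = (2 * L + y) * T := by field_simp
    linarith
  refine (mul_le_mul_of_nonneg_left hxy (by positivity)).trans ?_
  rw [div_mul_eq_mul_div, one_mul, div_le_iff₀ (by positivity)]
  -- From `T ≥ y / (2(2L + y))`, both cases yield `min 1 y / (2(2L + 1))`.
  rcases le_total 1 y with h | h
  · rw [min_eq_left h]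
    have h1 : (2 * L + y) * T ≤ (y * (2 * L + 1)) * T := by
      gcongr
      nlinarith
    have h2 : y * (1 / 2) ≤ y * ((2 * L + 1) * T) := by linarith
    have := le_of_mul_le_mul_left h2 hy0
    linarith
  · rw [min_eq_right h]
    have h1 : (2 * L + y) * T ≤ (2 * L + 1) * T := by gcongr
    linarith

/-- With equal means only the variance term `d * varGap` remains; `1 - e⁻ᵘ ≤ u` gives `T² ≤ d s² /
8`, more than enough for constant 1. -/
theorem tvDist_isotropic_le (μ : EuclideanSpace ℝ (Fin d)) {v s : ℝ} (hv : 0 < v) (hs : 0 ≤ s) :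
    tvDist (multivariateGaussian μ (Matrix.diagonal fun _ => v))
      (multivariateGaussian μ (Matrix.diagonal fun _ => v * (1 + s))) ≤ s * √d := by
  have hw : 0 < v * (1 + s) := by positivity
  have h := sq_tvDist_multivariateGaussian_le μ μ (v := fun _ => v) (w := fun _ => v * (1 + s))
    (fun _ => hv) fun _ => hw
  rw [covGap_diagonal (fun _ => hv) fun _ => hw] at h
  simp only [sub_self, ne_eq, OfNat.ofNat_ne_zero, not_false_eq_true, zero_pow, zero_div,
    Finset.sum_const_zero, add_zero, Finset.sum_const, Finset.card_univ, Fintype.card_fin,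
    nsmul_eq_mul] at h
  have hg : varGap v (v * (1 + s)) ≤ s ^ 2 / 16 := by
    refine (varGap_le hv hw).trans ?_
    have e : (v - v * (1 + s)) ^ 2 / (16 * (v * (v * (1 + s)))) = s ^ 2 / (16 * (1 + s)) := by
      field_simp
      ring
    rw [e]
    gcongr
    linarith
  have hexp := Real.add_one_le_exp (-(d * varGap v (v * (1 + s))))
  have hdg : d * varGap v (v * (1 + s)) ≤ d * (s ^ 2 / 16) := by gcongr
  refine abs_le_of_sq_le_sq' ?_ (by positivity) |>.2
  rw [mul_pow, Real.sq_sqrt (by positivity)]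
  have : 0 ≤ d * s ^ 2 := by positivity
  linarith

end Randomization

/-! ### Averaging over the clients. -/

theorem proposition1 :
    -- Randomization, with `x = σ² / c_clip² * √d`
    (∃ c C : ℝ, 0 < c ∧ 0 < C ∧
      ∀ (K d : ℕ), 0 < K →
      ∀ (μ : Fin K → EuclideanSpace ℝ (Fin d)) (cclip σ : ℝ), 0 < cclip → 0 ≤ σ →
        ∃ θ : ℝ,
          c * min 1 (σ ^ 2 / cclip ^ 2 * √(d : ℝ)) ≤ θ ∧
          θ ≤ C * (σ ^ 2 / cclip ^ 2 * √(d : ℝ)) ∧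
          privacyLeakage (fun k => isoGaussian (μ k) cclip)
              (fun k => randomize σ (isoGaussian (μ k) cclip)) = 1 - min 1 θ) ∧
    -- Sparsification, with variances of the retained block in `[a, b]`
    (∀ a b : ℝ, 0 < a → a ≤ b → ∃ c C : ℝ, 0 < c ∧ 0 < C ∧
      ∀ (K q r : ℕ), 0 < K →
      ∀ (μu : Fin K → EuclideanSpace ℝ (Fin q)) (μo μg : Fin K → EuclideanSpace ℝ (Fin r))
        (su : Fin K → Fin q → ℝ) (so sg : Fin K → Fin r → ℝ),
        (∀ k i, 0 < su k i) → (∀ k i, so k i ∈ Set.Icc a b) → (∀ k i, sg k i ∈ Set.Icc a b) →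
        ∃ f : Fin K → ℝ,
          (∀ k, c * min 1 (‖μo k - μg k‖ ^ 2) ≤ f k ∧
            f k ≤ covGap (blockCov (su k) (so k)) (blockCov (su k) (sg k))
              + C * ‖μo k - μg k‖ ^ 2 ∧
            f k ≤ covGap (blockCov (su k) (so k)) (blockCov (su k) (sg k))
              + C * ‖μo k - μg k‖) ∧
          privacyLeakage (fun k => blockGaussian (μu k) (μo k) (su k) (so k))
              (fun k => blockGaussian (μu k) (μg k) (su k) (sg k))
            = (1 / (K : ℝ)) * ∑ k, (1 - √2 * √(1 - Real.exp (-f k)))) := by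
  refine ⟨?_, ?_⟩
  · obtain ⟨c, hc, hlow⟩ := exists_le_tvDist_isotropic
    refine ⟨c, 1, hc, one_pos, fun K d hK μ cclip σ hclip hσ => ?_⟩
    have hK0 : (0 : ℝ) < K := by exact_mod_cast hK
    have hv : 0 < cclip ^ 2 := by positivity
    have hs : 0 ≤ σ ^ 2 / cclip ^ 2 := by positivity
    set x := σ ^ 2 / cclip ^ 2 * √(d : ℝ)
    set T : Fin K → ℝ := fun k =>
      tvDist (isoGaussian (μ k) cclip) (randomize σ (isoGaussian (μ k) cclip)) with hT
    have hTk : ∀ k, c * min 1 x ≤ T k ∧ T k ≤ x ∧ T k ≤ 1 := fun k => by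
      have e : cclip ^ 2 + σ ^ 2 = cclip ^ 2 * (1 + σ ^ 2 / cclip ^ 2) := by field_simp
      simp only [hT]
      rw [randomize_isoGaussian, isoGaussian_eq_diagonal, e]
      exact ⟨hlow d (μ k) _ _ hv hs, tvDist_isotropic_le (μ k) hv hs, tvDist_le_one _ _⟩
    have hconst : ∀ a : ℝ, (1 / (K : ℝ)) * ∑ _k : Fin K, a = a := fun a => by
      simp only [Finset.sum_const, Finset.card_univ, Fintype.card_fin, nsmul_eq_mul]
      field_simp
    have hK1 : 0 ≤ 1 / (K : ℝ) := by positivity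
    -- The average distance is itself at most 1, so the outer minimum is inactive.
    refine ⟨(1 / (K : ℝ)) * ∑ k, T k, ?_, ?_, ?_⟩
    · rw [← hconst (c * min 1 x)]
      exact mul_le_mul_of_nonneg_left (Finset.sum_le_sum fun k _ => (hTk k).1) hK1
    · rw [one_mul, ← hconst x]
      exact mul_le_mul_of_nonneg_left (Finset.sum_le_sum fun k _ => (hTk k).2.1) hK1
    · have hθ : (1 / (K : ℝ)) * ∑ k, T k ≤ 1 := by
        refine le_trans ?_ (hconst 1).le
        exact mul_le_mul_of_nonneg_left (Finset.sum_le_sum fun k _ => (hTk k).2.2) hK1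
      rw [min_eq_right hθ, privacyLeakage, Finset.sum_sub_distrib, mul_sub, hconst]
  · intro a b ha hab
    have hb : 0 < b := ha.trans_le hab
    refine ⟨((√(2 * Real.pi * b))⁻¹ * Real.exp (-1 / (2 * a))) ^ 2 / 2, 1 / (8 * a) + 1,
      by positivity, by positivity, fun K q r _ μu μo μg su so sg hu ho hg => ?_⟩
    choose f hlow hsq hlin htv using fun k =>
      exists_hellinger_exponent ha hab (μu k) (μo k) (μg k) (hu k) (ho k) (hg k)
    exact ⟨f, fun k => ⟨hlow k, hsq k, hlin k⟩, by simp only [privacyLeakage, htv]⟩
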